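/- Let $F=\langle x_0,x_1,x_2,\dots \mid x_i^{-1}x_jx_i=x_{j+1}\text{ for } i<j\rangle$ be Thompson's group, let $n\ge 2$, and let $X_n=\{x_0,x_1,\dots,x_n\}$. Let $\Gamma(F,X_n)$ be the Cayley graph, in which $a$ and $ax$ are adjacent for $a\in F$, $x\in X_n$, let $l_n$ denote word length with respect to $X_n$ (distance from the identity in $\Gamma(F,X_n)$), and let $B(m)=\{a\in F : l_n(a)\le m\}$. Call a group minimally almost convex with respect to a finite generating set if, for all sufficiently large $m$, any two points of the ball $B(m)$ of its Cayley graph at distance two are joined by a path of length at most $2m-1$ lying in $B(m)$. Then $X_n$ generates $F$, and $F$ is not minimally almost convex with respect to $X_n$. More precisely, for every integer $k\ge 1$ let $$g=x_nx_1^{k+1}x_0^{-k},\qquad h=x_1^{k+1}x_0^{-(k+1)}.$$ Then $l_n(g)=l_n(h)=2k+2$, the distance between $g$ and $h$ in $\Gamma(F,X_n)$ is $2$, and every path from $g$ to $h$ in $\Gamma(F,X_n)$ that lies in $B(2k+2)$ has length at least $4k+4$. -/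

import Mathlib

/-- The relators `x_i⁻¹ x_j x_i x_{j+1}⁻¹`, for `i < j`, of the standard infinite presentation of
Thompson's group `F`. -/
def thompsonRels : Set (FreeGroup ℕ) :=
  {r | ∃ i j : ℕ, i < j ∧
    r = (FreeGroup.of i)⁻¹ * FreeGroup.of j * FreeGroup.of i * (FreeGroup.of (j + 1))⁻¹}

/-- Thompson's group `F = ⟨x_k, k ≥ 0 | x_i⁻¹ x_j x_i = x_{j+1} for i < j⟩`. -/
abbrev ThompsonF : Type := PresentedGroup thompsonRels

namespace ThompsonF

/-- The standard generator `x_i` of Thompson's group `F`. -/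
def x (i : ℕ) : ThompsonF := PresentedGroup.of i

/-- The consecutive generating set `X_n = {x_0, x_1, …, x_n}`. -/
def consecutive (n : ℕ) : Set ThompsonF := {g | ∃ i ≤ n, g = x i}

end ThompsonF

/-- The Cayley graph `Γ(G, X)`: the edges join `g` and `g * a`, for `g ∈ G` and `a ∈ X`. -/
abbrev cayleyGraph {G : Type*} [Group G] (X : Set G) : SimpleGraph G :=
  SimpleGraph.mulCayley X

/-- The ball `B(m)` of radius `m` about the identity in the Cayley graph `Γ(G, X)`. -/
def cayleyBall {G : Type*} [Group G] (X : Set G) (m : ℕ) : Set G :=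
  {g | (cayleyGraph X).edist 1 g ≤ m}

/-- `G` is minimally almost convex with respect to `X`: for all sufficiently large `m`, any two
points of the ball `B(m)` at distance two are joined by a path of length at most `2m - 1` that
lies in `B(m)`. (The requirement is only for large `m`, as it already fails at `m = 1` whenever
`B(1)` has two points at distance two.) -/
def MinimallyAlmostConvex {G : Type*} [Group G] (X : Set G) : Prop :=
  ∃ m₀ : ℕ, ∀ m : ℕ, m₀ ≤ m → ∀ g ∈ cayleyBall X m, ∀ h ∈ cayleyBall X m,
    (cayleyGraph X).dist g h = 2 →
      ∃ p : (cayleyGraph X).Walk g h,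
        (∀ v ∈ p.support, v ∈ cayleyBall X m) ∧ p.length + 1 ≤ 2 * m

/-! `F` acts on the line, and two right germs are followed along a path from `g` to `h`: the one at
`0`, of log slope `k + 1` at both tips, and the one at `n - 1/2`, of log slope `1` at `g` and `0` at
`h`. Let `E` be the total exponent sum. While `E ≥ 2`, the second germ lies to the right of
everything that an edge can stretch or shrink, so its slope is still `1` at some vertex `v` of the
path with `E = 1` (`exists_mem_support_reach`).

A word for `v` needs separate stretches for the slopes of the two germs; with `v ∈ B(2k + 2)` this
leaves the germ at `0` a slope of at most `k` at `v` (`exists_counts_of_walk_one`). Left of the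
origin only `x_0` moves that germ, so the path has to bring it back to the origin both before and
after `v` to regain slope `k + 1` (`exists_counts_of_walk`). Counting edges gives `4k + 4`.

The exact distances come from explicit words above and exponent sums below (`dist_eq_of_edist_le`).
-/

namespace ThompsonF

/-- The universal property of the standard presentation. -/
def lift {G : Type*} [Group G] (f : ℕ → G) (hf : ∀ i j, i < j → f j * f i = f i * f (j + 1)) :
    ThompsonF →* G :=
  PresentedGroup.toGroup (f := f) <| by
    rintro r ⟨i, j, hij, rfl⟩
    simp only [map_mul, map_inv, FreeGroup.lift_apply_of]
    rw [mul_assoc (f i)⁻¹, hf i j hij]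
    group

@[simp]
theorem lift_x {G : Type*} [Group G] (f : ℕ → G)
    (hf : ∀ i j, i < j → f j * f i = f i * f (j + 1)) (i : ℕ) : lift f hf (x i) = f i :=
  PresentedGroup.toGroup.of _

theorem x_mul_x {i j : ℕ} (hij : i < j) : x j * x i = x i * x (j + 1) := by
  have h : (x i)⁻¹ * x j * x i * (x (j + 1))⁻¹ = 1 :=
    PresentedGroup.one_of_mem (rels := thompsonRels) ⟨i, j, hij, rfl⟩
  rw [mul_inv_eq_one, mul_assoc, inv_mul_eq_iff_eq_mul] at h
  exact h

theorem closure_consecutive {n : ℕ} (hn : 1 ≤ n) : Subgroup.closure (consecutive n) = ⊤ := by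
  have h0 : x 0 ∈ Subgroup.closure (consecutive n) := Subgroup.subset_closure ⟨0, by omega, rfl⟩
  have h1 (j : ℕ) : x (j + 1) ∈ Subgroup.closure (consecutive n) := by
    induction j with
    | zero => exact Subgroup.subset_closure ⟨1, hn, rfl⟩
    | succ j ih =>
      have h : x (j + 1 + 1) = (x 0)⁻¹ * (x (j + 1) * x 0) := by
        rw [x_mul_x (by omega : 0 < j + 1)]; group
      rw [h]
      exact mul_mem (inv_mem h0) (mul_mem ih h0)
  rw [eq_top_iff, ← PresentedGroup.closure_range_of, Subgroup.closure_le]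
  rintro _ ⟨j, rfl⟩
  cases j with
  | zero => exact h0
  | succ j => exact h1 j

/-! ### Exponent sums -/

/-- The exponent sum in the generator `x_0`. -/
def expZeroHom : ThompsonF →* Multiplicative ℤ :=
  lift (fun i => if i = 0 then .ofAdd 1 else 1) fun i j hij => by
    simp [mul_comm, show j ≠ 0 by omega]

/-- The exponent sum in the generators `x_i` with `i ≥ 1`. -/
def expPosHom : ThompsonF →* Multiplicative ℤ :=
  lift (fun i => if i = 0 then 1 else .ofAdd 1) fun i j hij => by
    simp [mul_comm, show j ≠ 0 by omega]

/-- The exponent sum of `g` in the generator `x_0`. -/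
def expZero (g : ThompsonF) : ℤ := (expZeroHom g).toAdd

/-- The exponent sum of `g` in the generators `x_i` with `i ≥ 1`. -/
def expPos (g : ThompsonF) : ℤ := (expPosHom g).toAdd

@[simp] theorem expZero_one : expZero 1 = 0 := by simp [expZero]
@[simp] theorem expPos_one : expPos 1 = 0 := by simp [expPos]
@[simp] theorem expZero_mul (g h : ThompsonF) : expZero (g * h) = expZero g + expZero h := by
  simp [expZero]
@[simp] theorem expPos_mul (g h : ThompsonF) : expPos (g * h) = expPos g + expPos h := by
  simp [expPos]
@[simp] theorem expZero_inv (g : ThompsonF) : expZero g⁻¹ = -expZero g := by simp [expZero]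
@[simp] theorem expPos_inv (g : ThompsonF) : expPos g⁻¹ = -expPos g := by simp [expPos]
@[simp] theorem expZero_pow (g : ThompsonF) (k : ℕ) : expZero (g ^ k) = k * expZero g := by
  simp [expZero]
@[simp] theorem expPos_pow (g : ThompsonF) (k : ℕ) : expPos (g ^ k) = k * expPos g := by
  simp [expPos]
@[simp] theorem expZero_x_zero : expZero (x 0) = 1 := by simp [expZero, expZeroHom]
@[simp] theorem expPos_x_zero : expPos (x 0) = 0 := by simp [expPos, expPosHom]
theorem expZero_x {i : ℕ} (hi : i ≠ 0) : expZero (x i) = 0 := by simp [expZero, expZeroHom, hi]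
theorem expPos_x {i : ℕ} (hi : i ≠ 0) : expPos (x i) = 1 := by simp [expPos, expPosHom, hi]

/-! ### The action on germs

`F` acts on the line by piecewise linear maps: `x_0` is the translation by `1`, and `x_{c+1}` fixes
the points left of `c` and stretches `[c, c + 1]` onto `[c, c + 2]`. A right germ is recorded as
its position together with the binary logarithm of its slope. -/

/-- The translation of germs by `1`. -/
def shiftGerm : Equiv.Perm (ℚ × ℤ) where
  toFun y := (y.1 + 1, y.2)
  invFun y := (y.1 - 1, y.2)
  left_inv y := by simp
  right_inv y := by simp

/-- The action on germs of the map that stretches `[c, c + 1]` onto `[c, c + 2]`. -/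
def stretchFun (c : ℚ) (y : ℚ × ℤ) : ℚ × ℤ :=
  if y.1 < c then y else if y.1 < c + 1 then (2 * y.1 - c, y.2 + 1) else (y.1 + 1, y.2)

/-- The inverse of `stretchFun`. -/
def shrinkFun (c : ℚ) (y : ℚ × ℤ) : ℚ × ℤ :=
  if y.1 < c then y else if y.1 < c + 2 then ((y.1 + c) / 2, y.2 - 1) else (y.1 - 1, y.2)

theorem stretchFun_cases (c : ℚ) (y : ℚ × ℤ) :
    (y.1 < c ∧ stretchFun c y = y) ∨
    (c ≤ y.1 ∧ y.1 < c + 1 ∧ stretchFun c y = (2 * y.1 - c, y.2 + 1)) ∨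
    (c + 1 ≤ y.1 ∧ stretchFun c y = (y.1 + 1, y.2)) := by
  unfold stretchFun
  split_ifs with h1 h2
  · exact .inl ⟨h1, rfl⟩
  · exact .inr (.inl ⟨not_lt.1 h1, h2, rfl⟩)
  · exact .inr (.inr ⟨not_lt.1 h2, rfl⟩)

/-- `stretchFun` as a permutation. -/
def stretchGerm (c : ℚ) : Equiv.Perm (ℚ × ℤ) where
  toFun := stretchFun c
  invFun := shrinkFun c
  left_inv y := by
    unfold shrinkFun
    rcases stretchFun_cases c y with ⟨h, e⟩ | ⟨h, h', e⟩ | ⟨h, e⟩ <;> rw [e]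
    · simp [h]
    · rw [if_neg (by simp only; linarith), if_pos (by simp only; linarith)]
      ext <;> simp
    · rw [if_neg (by simp only; linarith), if_neg (by simp only; linarith)]
      ext <;> simp
  right_inv y := by
    unfold shrinkFun
    split_ifs with h1 h2 <;> unfold stretchFun
    · simp [h1]
    · rw [if_neg (by simp only; linarith), if_pos (by simp only; linarith)]
      ext
      · simp only; ring
      · simp
    · rw [if_neg (by simp only; linarith), if_neg (by simp only; linarith)]
      ext <;> simp

/-- The permutation of germs induced by the generator `x_i`. -/
def genGerm : ℕ → Equiv.Perm (ℚ × ℤ)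
  | 0 => shiftGerm
  | c + 1 => stretchGerm c

/-- With `j = c + 1`, the map of `x_i` translates everything from `c` onwards by `1` and keeps
points left of `c` to the left of `c + 1`, so it carries the stretch at `c` to the stretch at `c +
1`. -/
theorem genGerm_comm {i j : ℕ} (hij : i < j) (y : ℚ × ℤ) :
    genGerm i (genGerm j y) = genGerm (j + 1) (genGerm i y) := by
  obtain ⟨c, rfl⟩ : ∃ c, j = c + 1 := ⟨j - 1, by omega⟩
  cases i with
  | zero =>
    change shiftGerm (stretchFun c y) = stretchFun (c + 1 : ℕ) (shiftGerm y)
    simp only [shiftGerm, Equiv.coe_fn_mk]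
    push_cast
    rcases stretchFun_cases c y with ⟨h, e⟩ | ⟨h, h', e⟩ | ⟨h, e⟩ <;> rw [e] <;> unfold stretchFun
    · rw [if_pos (by simp only; linarith)]
    · rw [if_neg (by simp only; linarith), if_pos (by simp only; linarith)]
      ext
      · simp only; ring
      · rfl
    · rw [if_neg (by simp only; linarith), if_neg (by simp only; linarith)]
  | succ b =>
    have hbc : (b : ℚ) + 1 ≤ c := by exact_mod_cast (by omega : b + 1 ≤ c)
    change stretchFun b (stretchFun c y) = stretchFun (c + 1 : ℕ) (stretchFun b y)
    push_cast
    rcases stretchFun_cases c y with ⟨h, e⟩ | ⟨h, h', e⟩ | ⟨h, e⟩ <;> rw [e]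
    · rcases stretchFun_cases b y with ⟨hb, e⟩ | ⟨hb, hb', e⟩ | ⟨hb, e⟩ <;> rw [e] <;>
        unfold stretchFun <;> rw [if_pos (by linarith)]
    · rw [show stretchFun b y = (y.1 + 1, y.2) by
        unfold stretchFun; rw [if_neg (by linarith), if_neg (by linarith)]]
      unfold stretchFun
      rw [if_neg (by simp only; linarith), if_neg (by simp only; linarith),
        if_neg (by simp only; linarith), if_pos (by simp only; linarith)]
      ext
      · simp only; ring
      · rfl
    · rw [show stretchFun b y = (y.1 + 1, y.2) by
        unfold stretchFun; rw [if_neg (by linarith), if_neg (by linarith)]]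
      unfold stretchFun
      rw [if_neg (by simp only; linarith), if_neg (by simp only; linarith),
        if_neg (by simp only; linarith), if_neg (by simp only; linarith)]

/-- The right action of `F` on germs. -/
def germHom : ThompsonF →* (Equiv.Perm (ℚ × ℤ))ᵐᵒᵖ :=
  lift (fun i => .op (genGerm i)) fun i j hij => by
    rw [← MulOpposite.op_mul, ← MulOpposite.op_mul]
    congr 1
    ext1 y
    exact genGerm_comm hij y

/-- The image of the germ `y` under `g`, for the right action of `F` on germs. -/
def germ (g : ThompsonF) (y : ℚ × ℤ) : ℚ × ℤ := (germHom g).unop y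

@[simp] theorem germ_one (y : ℚ × ℤ) : germ 1 y = y := by simp [germ]

@[simp] theorem germ_mul (g h : ThompsonF) (y : ℚ × ℤ) :
    germ (g * h) y = germ h (germ g y) := by simp [germ]

theorem germ_x_zero (y : ℚ × ℤ) : germ (x 0) y = (y.1 + 1, y.2) := by
  simp [germ, germHom, genGerm, shiftGerm]

theorem germ_x_succ (c : ℕ) (y : ℚ × ℤ) : germ (x (c + 1)) y = stretchFun c y := by
  simp [germ, germHom, genGerm, stretchGerm]

theorem germ_x_zero_pow_inv (k : ℕ) (y : ℚ × ℤ) : germ (x 0 ^ k)⁻¹ y = (y.1 - k, y.2) := by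
  induction k generalizing y with
  | zero => simp
  | succ k ih =>
    have h : germ (x 0)⁻¹ (germ (x 0) (y.1 - 1, y.2)) = (y.1 - 1, y.2) := by
      rw [← germ_mul, mul_inv_cancel, germ_one]
    rw [germ_x_zero] at h
    simp only [sub_add_cancel] at h
    rw [pow_succ, mul_inv_rev, germ_mul, h, ih]
    ext
    · push_cast; ring
    · rfl

theorem germ_x_one_pow_zero (k : ℕ) : germ (x 1 ^ k) (0, 0) = (0, (k : ℤ)) := by
  induction k with
  | zero => simp
  | succ k ih =>
    rw [pow_succ, germ_mul, ih, germ_x_succ 0]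
    simp [stretchFun]

theorem germ_x_one_pow_of_one_le (k : ℕ) {y : ℚ × ℤ} (hy : 1 ≤ y.1) :
    germ (x 1 ^ k) y = (y.1 + k, y.2) := by
  induction k with
  | zero => simp
  | succ k ih =>
    have hk : (0 : ℚ) ≤ k := k.cast_nonneg
    rw [pow_succ, germ_mul, ih, germ_x_succ 0, stretchFun, if_neg (by push_cast; linarith),
      if_neg (by push_cast; linarith)]
    ext
    · push_cast; ring
    · rfl

/-- The effect of an edge labelled by a generator on exponent sums and on germs. -/
def Step (n : ℕ) (u v : ThompsonF) : Prop :=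
  (expZero v = expZero u + 1 ∧ expPos v = expPos u ∧
    ∀ y, germ v y = ((germ u y).1 + 1, (germ u y).2)) ∨
  ∃ c : ℕ, c < n ∧ expZero v = expZero u ∧ expPos v = expPos u + 1 ∧
    ∀ y, germ v y = stretchFun c (germ u y)

theorem step_mul_x {n i : ℕ} (hi : i ≤ n) (u : ThompsonF) : Step n u (u * x i) := by
  cases i with
  | zero => exact .inl ⟨by simp, by simp, fun y => by rw [germ_mul, germ_x_zero]⟩
  | succ c =>
    exact .inr ⟨c, by omega, by simp [expZero_x], by simp [expPos_x],
      fun y => by rw [germ_mul, germ_x_succ]⟩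

theorem step_of_adj {n : ℕ} {u v : ThompsonF} (h : (cayleyGraph (consecutive n)).Adj u v) :
    Step n u v ∨ Step n v u := by
  obtain ⟨-, _, ⟨i, hi, rfl⟩, rfl | rfl⟩ := (SimpleGraph.mulCayley_adj' _ _ _).1 h
  · exact .inl (step_mul_x hi u)
  · exact .inr (step_mul_x hi v)

/-! ### Word length and exponent sums -/

theorem edist_mul_x_le {n i : ℕ} (hi : i ≤ n) (u : ThompsonF) :
    (cayleyGraph (consecutive n)).edist u (u * x i) ≤ 1 := by
  -- Adjacency requires distinct vertices; the case split avoids proving `x i ≠ 1`.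
  by_cases h : u = u * x i
  · rw [← h]; simp
  · refine (SimpleGraph.edist_eq_one_iff_adj.2 ?_).le
    exact (SimpleGraph.mulCayley_adj' _ _ _).2 ⟨h, x i, ⟨i, hi, rfl⟩, .inl rfl⟩

theorem edist_mul_x_inv_le {n i : ℕ} (hi : i ≤ n) (u : ThompsonF) :
    (cayleyGraph (consecutive n)).edist u (u * (x i)⁻¹) ≤ 1 := by
  rw [SimpleGraph.edist_comm]
  simpa using edist_mul_x_le hi (u * (x i)⁻¹)

theorem edist_mul_pow_le {n : ℕ} {a : ThompsonF}
    (ha : ∀ u, (cayleyGraph (consecutive n)).edist u (u * a) ≤ 1) (u : ThompsonF) (k : ℕ) :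
    (cayleyGraph (consecutive n)).edist u (u * a ^ k) ≤ k := by
  induction k with
  | zero => simp
  | succ k ih =>
    rw [pow_succ, ← mul_assoc]
    push_cast
    exact SimpleGraph.edist_triangle.trans (add_le_add ih (ha _))

theorem abs_exp_sub_le_length {n : ℕ} {u v : ThompsonF}
    (p : (cayleyGraph (consecutive n)).Walk u v) :
    |expZero u - expZero v| + |expPos u - expPos v| ≤ p.length := by
  induction p with
  | nil => simp
  | @cons u v w h p ih =>
    rw [SimpleGraph.Walk.length_cons]
    push_cast
    rcases step_of_adj h with (⟨h0, h1, -⟩ | ⟨c, -, h0, h1, -⟩) | (⟨h0, h1, -⟩ | ⟨c, -, h0, h1, -⟩) <;>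
      simp only [abs_eq_max_neg] at ih ⊢ <;> omega

theorem dist_eq_of_edist_le {n m : ℕ} {u v : ThompsonF}
    (h : (cayleyGraph (consecutive n)).edist u v ≤ m)
    (h' : (m : ℤ) ≤ |expZero u - expZero v| + |expPos u - expPos v|) :
    (cayleyGraph (consecutive n)).dist u v = m := by
  have hne : (cayleyGraph (consecutive n)).edist u v ≠ ⊤ := ne_top_of_le_ne_top (by simp) h
  obtain ⟨p, hp⟩ := SimpleGraph.exists_walk_of_edist_ne_top hne
  have hpm : p.length ≤ m := by rw [← hp] at h; exact_mod_cast h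
  have := abs_exp_sub_le_length p
  have hd : (cayleyGraph (consecutive n)).dist u v = p.length := by
    rw [SimpleGraph.dist, ← hp]; rfl
  omega

/-! ### Counting edges along walks by means of germs -/

/-- Splitting counts: a walk from `u` to the identity has at least as many inverse stretches as
the slopes of two germs at `u` require; no stretch serves both germs, unless an
additional one had to be undone. -/
theorem exists_counts_of_walk_one {n : ℕ} {a b : ℚ} {m : ℤ} (ham : a < m) (hmb : m ≤ b)
    {u v : ThompsonF} (p : (cayleyGraph (consecutive n)).Walk u v) (hv : v = 1) :
    ∃ A S M : ℕ, A + S + M = p.length ∧ -expZero u ≤ A ∧ (S : ℤ) - M = expPos u ∧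
      ((germ u (a, 0)).2 + 1 ≤ S ∨
        ((germ u (a, 0)).2 ≤ S ∧ (germ u (a, 0)).2 + (germ u (b, 0)).2 ≤ S ∧
          ∃ m : ℤ, (germ u (a, 0)).1 < m ∧ m ≤ (germ u (b, 0)).1)) := by
  induction p with
  | nil => subst hv; exact ⟨0, 0, 0, by simp, by simp, by simp, .inr ⟨by simp, by simp, m, by simpa using ⟨ham, hmb⟩⟩⟩
  | @cons u v w h p ih =>
    obtain ⟨A, S, M, hl, hA, hSM, hS⟩ := ih hv
    rw [SimpleGraph.Walk.length_cons]
    rcases step_of_adj h with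
      (⟨h0, h1, hg⟩ | ⟨c, -, h0, h1, hg⟩) | (⟨h0, h1, hg⟩ | ⟨c, -, h0, h1, hg⟩)
    · refine ⟨A + 1, S, M, by omega, by omega, by omega, ?_⟩
      rw [hg, hg] at hS
      refine hS.imp id fun ⟨h2, h3, m, h4, h5⟩ => ⟨h2, h3, m - 1, ?_, ?_⟩ <;> push_cast <;>
        simp only at h4 h5 <;> linarith
    · refine ⟨A, S, M + 1, by omega, by omega, by omega, ?_⟩
      rw [hg, hg] at hS
      rcases stretchFun_cases c (germ u (a, 0)) with ⟨ha, ea⟩ | ⟨ha, ha', ea⟩ | ⟨ha, ea⟩ <;>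
        rw [ea] at hS
      · refine hS.imp id fun ⟨h2, h3, m, h4, h5⟩ => ?_
        rcases stretchFun_cases c (germ u (b, 0)) with ⟨hb, eb⟩ | ⟨hb, hb', eb⟩ | ⟨hb, eb⟩ <;>
          rw [eb] at h3 h5
        · exact ⟨h2, h3, m, h4, h5⟩
        · simp only at h3
          exact ⟨h2, by omega, c, by exact_mod_cast ha, by exact_mod_cast hb⟩
        · exact ⟨h2, by omega, c, by exact_mod_cast ha, by push_cast; linarith⟩
      -- The slope at `v` exceeds that at `u` by one, so the count for `v` already has the surplus.
      · left
        simp only at hS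
        omega
      · refine hS.imp id fun ⟨h2, h3, m, h4, h5⟩ => ?_
        simp only at h2 h3 h4
        have hcm : (c : ℚ) + 2 < m := by linarith
        rcases stretchFun_cases c (germ u (b, 0)) with ⟨hb, eb⟩ | ⟨hb, hb', eb⟩ | ⟨hb, eb⟩ <;>
          rw [eb] at h3 h5
        · linarith
        · simp only at h5
          linarith
        · simp only at h5
          exact ⟨h2, h3, m - 1, by push_cast; linarith, by push_cast; linarith⟩
    · refine ⟨A + 1, S, M, by omega, by omega, by omega, ?_⟩
      rw [hg, hg]
      refine hS.imp id fun ⟨h2, h3, m, h4, h5⟩ => ⟨h2, h3, m + 1, ?_, ?_⟩ <;> push_cast <;>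
        linarith
    · refine ⟨A, S + 1, M, by omega, by omega, by omega, ?_⟩
      rw [hg, hg]
      rcases stretchFun_cases c (germ v (a, 0)) with ⟨ha, ea⟩ | ⟨ha, ha', ea⟩ | ⟨ha, ea⟩ <;>
        rw [ea]
      · left
        omega
      · rcases hS with hS | ⟨h2, h3, m, h4, h5⟩
        · left
          simp only
          omega
        -- The separating integer puts the second germ beyond `[c, c + 1)`: the edge changes the
        -- slope of the first germ only, and `c + 2` separates their images.
        have hcm : (c : ℤ) + 1 ≤ m := by
          have : (c : ℚ) < m := by linarith
          exact_mod_cast this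
        have hcm' : (c : ℚ) + 1 ≤ m := by exact_mod_cast hcm
        rcases stretchFun_cases c (germ v (b, 0)) with ⟨hb, eb⟩ | ⟨hb, hb', eb⟩ | ⟨hb, eb⟩
        · linarith
        · linarith
        · right
          rw [eb]
          refine ⟨by simp only; omega, by simp only; omega, c + 2, ?_, ?_⟩ <;> push_cast <;> linarith
      · left
        simp only
        omega

theorem stretchFun_slope (c : ℚ) (y : ℚ × ℤ) :
    y.2 ≤ (stretchFun c y).2 ∧ (stretchFun c y).2 ≤ y.2 + 1 := by
  unfold stretchFun
  split_ifs <;> simp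

/-- A walk from `u` to a vertex `t` at which the germ `y` lies left of the origin, without having
been moved by the stretches: either the same holds at `u`, with the same slope, or
the walk passes through a vertex at which the germ is at the origin. -/
theorem exists_counts_of_walk {n : ℕ} {y : ℚ × ℤ} {u t : ThompsonF}
    (p : (cayleyGraph (consecutive n)).Walk u t) (ht : expZero t < 0)
    (hy : (germ t y).1 = expZero t) :
    ∃ A S M : ℕ, A + S + M = p.length ∧ |expZero u - expZero t| ≤ A ∧
      (S : ℤ) - M = expPos t - expPos u ∧ (∀ z, (germ u z).2 ≤ (germ t z).2 + M) ∧
      ((expZero u < 0 ∧ (germ u y).1 = expZero u ∧ (germ u y).2 = (germ t y).2) ∨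
        |expZero u| - expZero t ≤ A) := by
  induction p with
  | nil => exact ⟨0, 0, 0, by simp, by simp, by simp, by simp, .inl ⟨ht, hy, rfl⟩⟩
  | @cons u v w h p ih =>
    obtain ⟨A, S, M, hl, hA, hSM, hS, hp⟩ := ih ht hy
    rw [SimpleGraph.Walk.length_cons]
    simp only [abs_eq_max_neg] at hA hp ⊢
    rcases step_of_adj h with
      (⟨h0, h1, hg⟩ | ⟨c, -, h0, h1, hg⟩) | (⟨h0, h1, hg⟩ | ⟨c, -, h0, h1, hg⟩)
    · refine ⟨A + 1, S, M, by omega, by omega, by omega, fun z => ?_, ?_⟩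
      · simpa [hg] using hS z
      · rcases hp with ⟨h2, h3, h4⟩ | hp
        · rw [hg, h0] at h3
          rw [hg] at h4
          push_cast at h3
          exact .inl ⟨by omega, by linarith, h4⟩
        · right; omega
    · refine ⟨A, S + 1, M, by omega, by omega, by omega, fun z => ?_, ?_⟩
      · have := hS z
        rw [hg] at this
        have := stretchFun_slope c (germ u z)
        omega
      · rcases hp with ⟨h2, h3, h4⟩ | hp
        · rw [hg] at h3 h4
          have h2' : (expZero v : ℚ) < 0 := by exact_mod_cast h2
          have hc : (0 : ℚ) ≤ c := c.cast_nonneg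
          rcases stretchFun_cases c (germ u y) with ⟨h', e⟩ | ⟨h', h'', e⟩ | ⟨h', e⟩ <;>
            rw [e] at h3 h4
          · rw [← h0]; exact .inl ⟨h2, h3, h4⟩
          · simp only at h3; linarith
          · simp only at h3; linarith
        · right; omega
    · refine ⟨A + 1, S, M, by omega, by omega, by omega, fun z => ?_, ?_⟩
      · simpa [hg] using hS z
      · rcases hp with ⟨h2, h3, h4⟩ | hp
        -- If this fails, the germ sits at the origin at `u`, and `hA` already pays for the way from
        -- there to `t`.
        · by_cases hu : expZero u < 0
          · refine .inl ⟨hu, ?_, ?_⟩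
            · rw [hg, h0, h3]; push_cast; rfl
            · rw [hg, h4]
          · right; omega
        · right; omega
    · refine ⟨A, S, M + 1, by omega, by omega, by omega, fun z => ?_, ?_⟩
      · have := hS z
        rw [hg]
        have := stretchFun_slope c (germ v z)
        omega
      · rcases hp with ⟨h2, h3, h4⟩ | hp
        · have h2' : (expZero v : ℚ) < 0 := by exact_mod_cast h2
          have hc : (0 : ℚ) ≤ c := c.cast_nonneg
          rw [hg, h0, show stretchFun c (germ v y) = germ v y by
            rw [stretchFun, if_pos (by linarith)]]
          exact .inl ⟨h2, h3, h4⟩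
        · right; omega

/-- A walk along which the slope of a germ drops has an edge before which the germ
comes within reach of the generators, having only been translated. -/
theorem exists_mem_support_reach {n : ℕ} {z : ℚ × ℤ} {u t : ThompsonF}
    (p : (cayleyGraph (consecutive n)).Walk u t) {r : ℤ}
    (hu : (germ u z).1 = n - 1 + expZero u + expPos u) (hr : r = (germ u z).2)
    (hu' : 2 ≤ expZero u + expPos u) (ht : (germ t z).2 ≠ r) :
    ∃ v ∈ p.support, expZero v + expPos v = 1 ∧ (germ v z).2 = r := by
  obtain ⟨⟨⟨a, b⟩, hab⟩, hd, ⟨h1, h2, h3⟩, hb⟩ := p.exists_boundary_dart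
    {v | (germ v z).1 = n - 1 + expZero v + expPos v ∧ (germ v z).2 = r ∧
      2 ≤ expZero v + expPos v} ⟨hu, hr.symm, hu'⟩ (fun h => ht h.2.1)
  refine ⟨b, p.dart_snd_mem_support_of_mem_darts hd, ?_⟩
  simp only [Set.mem_ofPred_eq, not_and, not_le] at hab h1 h2 h3 hb ⊢
  have h3' : (2 : ℚ) ≤ expZero a + expPos a := by exact_mod_cast h3
  -- At `a` the germ is at `n + 1` or beyond, while `c + 2 ≤ n + 1`: every edge translates it, even
  -- the one leaving the set. Hence the exit is through the exponent sum, which drops to `1`.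
  have key : (germ b z).1 = n - 1 + expZero b + expPos b ∧ (germ b z).2 = r ∧
      1 ≤ expZero b + expPos b := by
    rcases step_of_adj hab with
      (⟨e0, e1, hg⟩ | ⟨c, hc, e0, e1, hg⟩) | (⟨e0, e1, hg⟩ | ⟨c, hc, e0, e1, hg⟩)
    · refine ⟨?_, ?_, by omega⟩ <;> rw [hg]
      · rw [e0, e1, h1]; push_cast; ring
      · exact h2
    · have hc' : (c : ℚ) + 1 ≤ n := by exact_mod_cast hc
      refine ⟨?_, ?_, by omega⟩ <;>
        rw [hg, stretchFun, if_neg (by linarith), if_neg (by linarith)]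
      · rw [e0, e1, h1]; push_cast; ring
      · exact h2
    · rw [hg] at h1 h2
      rw [e0, e1] at h1
      push_cast at h1
      exact ⟨by linarith, h2, by omega⟩
    · have hc' : (c : ℚ) + 1 ≤ n := by exact_mod_cast hc
      rw [hg] at h1 h2
      rw [e0, e1] at h1
      rw [e0, e1] at h3'
      push_cast at h1 h3'
      rcases stretchFun_cases c (germ b z) with ⟨h', e⟩ | ⟨h', h'', e⟩ | ⟨h', e⟩ <;>
        rw [e] at h1 h2
      · linarith
      · simp only at h1; linarith
      · simp only at h1 h2
        exact ⟨by linarith, h2, by omega⟩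
  exact ⟨by have := hb key.1 key.2.1; omega, key.2.1⟩

/-! ### The two tips -/

theorem germ_left_tip_origin {n : ℕ} (hn : 2 ≤ n) (k : ℕ) :
    germ (x n * x 1 ^ (k + 1) * (x 0 ^ k)⁻¹) (0, 0) = (-(k : ℚ), (k : ℤ) + 1) := by
  obtain ⟨c, rfl⟩ : ∃ c, n = c + 1 := ⟨n - 1, by omega⟩
  have hc : (1 : ℚ) ≤ c := by exact_mod_cast (by omega : 1 ≤ c)
  rw [germ_mul, germ_mul, germ_x_succ, stretchFun, if_pos (by simp only; linarith),
    germ_x_one_pow_zero, germ_x_zero_pow_inv]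
  ext <;> simp

theorem germ_left_tip {n : ℕ} (hn : 2 ≤ n) (k : ℕ) :
    germ (x n * x 1 ^ (k + 1) * (x 0 ^ k)⁻¹) ((n : ℚ) - 1 / 2, 0) = ((n : ℚ) + 1, 1) := by
  obtain ⟨c, rfl⟩ : ∃ c, n = c + 1 := ⟨n - 1, by omega⟩
  have hc : (1 : ℚ) ≤ c := by exact_mod_cast (by omega : 1 ≤ c)
  rw [germ_mul, germ_mul, germ_x_succ, stretchFun, if_neg (by push_cast; linarith),
    if_pos (by push_cast; linarith),
    germ_x_one_pow_of_one_le _ (by push_cast; linarith), germ_x_zero_pow_inv]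
  ext
  · push_cast; ring
  · simp

theorem germ_right_tip_origin (k : ℕ) :
    germ (x 1 ^ (k + 1) * (x 0 ^ (k + 1))⁻¹) (0, 0) = (-(k : ℚ) - 1, (k : ℤ) + 1) := by
  rw [germ_mul, germ_x_one_pow_zero, germ_x_zero_pow_inv]
  ext
  · push_cast; ring
  · simp

theorem germ_right_tip (k : ℕ) {y : ℚ × ℤ} (hy : 1 ≤ y.1) :
    germ (x 1 ^ (k + 1) * (x 0 ^ (k + 1))⁻¹) y = y := by
  rw [germ_mul, germ_x_one_pow_of_one_le _ hy, germ_x_zero_pow_inv]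
  ext <;> simp

theorem edist_left_tip_le {n : ℕ} (hn : 2 ≤ n) (k : ℕ) :
    (cayleyGraph (consecutive n)).edist 1 (x n * x 1 ^ (k + 1) * (x 0 ^ k)⁻¹) ≤ (2 * k + 2 : ℕ) := by
  have h1 := edist_mul_x_le (le_refl n) 1
  have h2 := edist_mul_pow_le (edist_mul_x_le (by omega : 1 ≤ n)) (1 * x n) (k + 1)
  have h3 := edist_mul_pow_le (edist_mul_x_inv_le (by omega : 0 ≤ n)) (1 * x n * x 1 ^ (k + 1)) k
  rw [inv_pow] at h3
  have h := SimpleGraph.edist_triangle.trans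
    (add_le_add (SimpleGraph.edist_triangle.trans (add_le_add h1 h2)) h3)
  rw [one_mul] at h
  refine h.trans (le_of_eq ?_)
  push_cast
  ring

theorem edist_right_tip_le {n : ℕ} (hn : 2 ≤ n) (k : ℕ) :
    (cayleyGraph (consecutive n)).edist 1 (x 1 ^ (k + 1) * (x 0 ^ (k + 1))⁻¹) ≤
      (2 * k + 2 : ℕ) := by
  have h2 := edist_mul_pow_le (edist_mul_x_le (by omega : 1 ≤ n)) 1 (k + 1)
  have h3 := edist_mul_pow_le (edist_mul_x_inv_le (by omega : 0 ≤ n)) (1 * x 1 ^ (k + 1)) (k + 1)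
  rw [inv_pow] at h3
  have h := SimpleGraph.edist_triangle.trans (add_le_add h2 h3)
  rw [one_mul] at h
  refine h.trans (le_of_eq ?_)
  push_cast
  ring

theorem x_mul_x_zero_pow_inv {i : ℕ} (hi : 1 ≤ i) (k : ℕ) :
    x (i + k) * (x 0 ^ k)⁻¹ = (x 0 ^ k)⁻¹ * x i := by
  induction k with
  | zero => simp
  | succ k ih =>
    have h : x (i + (k + 1)) * (x 0)⁻¹ = (x 0)⁻¹ * x (i + k) := by
      rw [mul_inv_eq_iff_eq_mul, mul_assoc, x_mul_x (by omega : 0 < i + k)]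
      group
    rw [pow_succ, mul_inv_rev, ← mul_assoc, h, mul_assoc, ih, mul_assoc]

theorem x_mul_x_one_pow {i : ℕ} (hi : 2 ≤ i) (k : ℕ) :
    x i * x 1 ^ k = x 1 ^ k * x (i + k) := by
  induction k with
  | zero => simp
  | succ k ih =>
    rw [pow_succ, ← mul_assoc, ih, mul_assoc, x_mul_x (by omega : 1 < i + k), mul_assoc]
    rfl

/-- Passing `x n` through `x 1 ^ (k + 1)` raises its index by `k + 1`, and passing through the
inverse power of `x 0` lowers it back. This is the midpoint of a path of length two between the
tips. -/
theorem left_tip_mul_inv {n : ℕ} (hn : 2 ≤ n) (k : ℕ) :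
    x n * x 1 ^ (k + 1) * (x 0 ^ k)⁻¹ * (x 0)⁻¹ =
      x 1 ^ (k + 1) * (x 0 ^ (k + 1))⁻¹ * x n := by
  rw [mul_assoc _ _ (x 0)⁻¹, ← mul_inv_rev, ← pow_succ', x_mul_x_one_pow hn, mul_assoc,
    x_mul_x_zero_pow_inv (by omega), mul_assoc]

theorem edist_tips_le {n : ℕ} (hn : 2 ≤ n) (k : ℕ) :
    (cayleyGraph (consecutive n)).edist (x n * x 1 ^ (k + 1) * (x 0 ^ k)⁻¹)
      (x 1 ^ (k + 1) * (x 0 ^ (k + 1))⁻¹) ≤ (2 : ℕ) := by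
  have h1 := edist_mul_x_inv_le (by omega : 0 ≤ n) (x n * x 1 ^ (k + 1) * (x 0 ^ k)⁻¹)
  have h2 := edist_mul_x_le (le_refl n) (x 1 ^ (k + 1) * (x 0 ^ (k + 1))⁻¹)
  rw [left_tip_mul_inv hn] at h1
  rw [SimpleGraph.edist_comm] at h2
  exact (SimpleGraph.edist_triangle.trans (add_le_add h1 h2)).trans (by norm_num)

theorem exp_left_tip {n : ℕ} (hn : 2 ≤ n) (k : ℕ) :
    expZero (x n * x 1 ^ (k + 1) * (x 0 ^ k)⁻¹) = -k ∧
      expPos (x n * x 1 ^ (k + 1) * (x 0 ^ k)⁻¹) = k + 2 := by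
  constructor
  · simp [expZero_x, show n ≠ 0 by omega]
  · simp [expPos_x, show n ≠ 0 by omega]; ring

theorem exp_right_tip (k : ℕ) :
    expZero (x 1 ^ (k + 1) * (x 0 ^ (k + 1))⁻¹) = -k - 1 ∧
      expPos (x 1 ^ (k + 1) * (x 0 ^ (k + 1))⁻¹) = k + 1 := by
  constructor
  · simp [expZero_x]; ring
  · simp [expPos_x]

/-! ### The lower bound for paths inside the ball -/

theorem le_length_of_support_subset_ball {n k : ℕ} (hn : 2 ≤ n) (hk : 1 ≤ k)
    (p : (cayleyGraph (consecutive n)).Walk (x n * x 1 ^ (k + 1) * (x 0 ^ k)⁻¹)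
      (x 1 ^ (k + 1) * (x 0 ^ (k + 1))⁻¹))
    (hp : ∀ v ∈ p.support, v ∈ cayleyBall (consecutive n) (2 * k + 2)) :
    4 * k + 4 ≤ p.length := by
  classical
  have hn' : (2 : ℚ) ≤ n := by exact_mod_cast hn
  obtain ⟨eg0, eg1⟩ := exp_left_tip hn k
  obtain ⟨eh0, eh1⟩ := exp_right_tip k
  have ga := germ_left_tip_origin hn k
  have gb := germ_left_tip hn k
  have ha := germ_right_tip_origin k
  have hb := germ_right_tip k (y := ((n : ℚ) - 1 / 2, 0)) (by simp only; linarith)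
  generalize x n * x 1 ^ (k + 1) * (x 0 ^ k)⁻¹ = g at *
  generalize x 1 ^ (k + 1) * (x 0 ^ (k + 1))⁻¹ = h at *
  obtain ⟨v, hv, hsum, hslope⟩ := exists_mem_support_reach (r := 1) p
    (by rw [gb, eg0, eg1]; push_cast; ring) (by rw [gb]) (by omega) (by rw [hb]; simp)
  have hball : (cayleyGraph (consecutive n)).edist 1 v ≤ (2 * k + 2 : ℕ) := hp v hv
  rw [SimpleGraph.edist_comm] at hball
  obtain ⟨w, hw⟩ := SimpleGraph.exists_walk_of_edist_ne_top
    (ne_top_of_le_ne_top (ENat.natCast_ne_top _) hball)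
  rw [← hw] at hball
  have hwl : w.length ≤ 2 * k + 2 := by exact_mod_cast hball
  obtain ⟨A, S, M, hl, hA, hSM, hS⟩ := exists_counts_of_walk_one (a := 0)
    (b := (n : ℚ) - 1 / 2) (m := 1) (by norm_num) (by push_cast; linarith) w rfl
  -- The second germ has slope `1`, so either alternative gives `S ≥ D + 1`, with `D` the slope at
  -- `0`. As `A ≥ expPos v - 1 = S - M - 1`, the length is at least `2S - 1`, whence `S ≤ k + 1`.
  have hD : (germ v (0, 0)).2 ≤ k := by
    rcases hS with hS | ⟨-, hS, -⟩ <;> omega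
  obtain ⟨A₁, S₁, M₁, hl₁, -, hSM₁, -, hc₁⟩ := exists_counts_of_walk (y := (0, 0))
    (p.takeUntil v hv).reverse (by omega) (by rw [ga, eg0]; push_cast; rfl)
  obtain ⟨A₂, S₂, M₂, hl₂, -, hSM₂, hE₂, hc₂⟩ := exists_counts_of_walk (y := (0, 0))
    (p.dropUntil v hv) (by omega) (by rw [ha, eh0]; push_cast; rfl)
  -- The slope of the second germ still has to fall from `1` to `0` between `v` and `h`.
  have hM₂ : 1 ≤ M₂ := by
    have := hE₂ ((n : ℚ) - 1 / 2, 0)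
    rw [hb, hslope] at this
    simp only at this
    omega
  have hA₁ : |expZero v| - expZero g ≤ A₁ := by
    refine hc₁.resolve_left fun hc => ?_
    have := hc.2.2
    rw [ga] at this
    simp only at this
    omega
  have hA₂ : |expZero v| - expZero h ≤ A₂ := by
    refine hc₂.resolve_left fun hc => ?_
    have := hc.2.2
    rw [ha] at this
    simp only at this
    omega
  have hlen : p.length = (p.takeUntil v hv).length + (p.dropUntil v hv).length := by
    rw [← SimpleGraph.Walk.length_append, SimpleGraph.Walk.take_spec]
  rw [SimpleGraph.Walk.length_reverse] at hl₁
  -- With `e = expZero v` and `expPos v = 1 - e`, the `x_0`-edges number at least `2|e| + 2k + 1`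
  -- and the others at least `(k + 1 + e) + (k + e + 2)`; the sum is `4k + 4 + 2(|e| + e)`.
  simp only [abs_eq_max_neg] at hA₁ hA₂
  omega

end ThompsonF

theorem theorem4p1 (n : ℕ) (hn : 2 ≤ n) :
    Subgroup.closure (ThompsonF.consecutive n) = ⊤ ∧
    ¬ MinimallyAlmostConvex (ThompsonF.consecutive n) ∧
    ∀ k : ℕ, 1 ≤ k → ∀ g h : ThompsonF,
      g = ThompsonF.x n * ThompsonF.x 1 ^ (k + 1) * (ThompsonF.x 0 ^ k)⁻¹ →
      h = ThompsonF.x 1 ^ (k + 1) * (ThompsonF.x 0 ^ (k + 1))⁻¹ →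
      (cayleyGraph (ThompsonF.consecutive n)).dist 1 g = 2 * k + 2 ∧
      (cayleyGraph (ThompsonF.consecutive n)).dist 1 h = 2 * k + 2 ∧
      (cayleyGraph (ThompsonF.consecutive n)).dist g h = 2 ∧
      ∀ p : (cayleyGraph (ThompsonF.consecutive n)).Walk g h,
        (∀ v ∈ p.support, v ∈ cayleyBall (ThompsonF.consecutive n) (2 * k + 2)) →
          4 * k + 4 ≤ p.length := by
  have dist_tips (k : ℕ) := ThompsonF.dist_eq_of_edist_le (ThompsonF.edist_tips_le hn k) (by
    rw [(ThompsonF.exp_left_tip hn k).1, (ThompsonF.exp_left_tip hn k).2,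
      (ThompsonF.exp_right_tip k).1, (ThompsonF.exp_right_tip k).2]
    simp only [abs_eq_max_neg]
    omega)
  refine ⟨ThompsonF.closure_consecutive (by omega), ?_, ?_⟩
  · rintro ⟨m₀, h⟩
    -- Taking `k = m₀ + 1` ensures `k ≥ 1`; for `m = 2k + 2` the allowed length `2m - 1 = 4k + 3` is
    -- one too short.
    obtain ⟨p, hp, hl⟩ := h (2 * (m₀ + 1) + 2) (by omega) _ (ThompsonF.edist_left_tip_le hn (m₀ + 1))
      _ (ThompsonF.edist_right_tip_le hn (m₀ + 1)) (dist_tips (m₀ + 1))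
    have := ThompsonF.le_length_of_support_subset_ball hn (by omega) p hp
    omega
  · rintro k hk _ _ rfl rfl
    refine ⟨ThompsonF.dist_eq_of_edist_le (ThompsonF.edist_left_tip_le hn k) ?_,
      ThompsonF.dist_eq_of_edist_le (ThompsonF.edist_right_tip_le hn k) ?_, dist_tips k,
      fun p hp => ThompsonF.le_length_of_support_subset_ball hn hk p hp⟩
    · rw [(ThompsonF.exp_left_tip hn k).1, (ThompsonF.exp_left_tip hn k).2]
      simp only [abs_eq_max_neg, ThompsonF.expZero_one, ThompsonF.expPos_one]
      omega
    · rw [(ThompsonF.exp_right_tip k).1, (ThompsonF.exp_right_tip k).2]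
      simp only [abs_eq_max_neg, ThompsonF.expZero_one, ThompsonF.expPos_one]
      omega
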